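/- Let $n\ge 0$, $[n]=\{1,\dots,n\}$, let $[n]'=\{1',\dots,n'\}$ be a disjoint copy of $[n]$, and write $A'=\{x' : x\in A\}$ for $A\subseteq[n]$. Let $\mathcal P_n$ be the partition monoid: its elements are the partitions of $[n]\cup[n]'$, and $ab$ is obtained by drawing $a$ above $b$, identifying each vertex $x'$ of $a$ with the vertex $x$ of $b$, taking connected components, and deleting the middle row. For $a,b\in\mathcal P_n$ write $a\sim_{\mathfrak n}b$ (natural conjugacy) if there are $g,h\in\mathcal P_n$ with $ag=gb$, $bh=ha$, $hag=b$ and $gbh=a$; the $\mathfrak n$-conjugacy class of $a$ is $\{b\in\mathcal P_n : b\sim_{\mathfrak n}a\}$. For $b\in\mathcal P_n$, $\emptyset\neq A\subseteq[n]$ and a block $s$ of $b$, put $s_A=s\cap(A\cup A')$. Let $b_A$ be the partition of $A\cup A'$ whose blocks are the nonempty sets $s_A$, where $s$ runs through the blocks of $b$; whenever $s_A$ is called a block of $b_A$, $s$ denotes the corresponding block of $b$. Call $b_A$ *non-trivial* if $|A|\ge 2$. Call it *connected* if the only equivalence relation on $A$ that relates $x$ and $y$ whenever $x,y\in A$ lie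 in the same block of $b_A$ or $x',y'\in A'$ lie in the same block of $b_A$ is the universal relation. A block of $b_A$ is *transversal* if it meets both $A$ and $A'$; $b_A$ is *transversal-free* if it has no transversal block, and *1-transversal* if it has exactly one. The partition $b$ is in *$\mathfrak n$-normal form* if: 1. for every non-trivial, connected, transversal-free $b_A$ there are distinct blocks $s_A,t_A$ of $b_A$ with $s_A\ne s$ and $t_A\ne t$ such that either $s_A,t_A\subseteq A$ or $s_A,t_A\subseteq A'$; and 2. for every non-trivial, connected, 1-transversal $b_A$, with transversal block $s_A$, there is a block $t_A\ne s_A$ of $b_A$ with $t\ne t_A$. For $a\in\mathcal P_n$ and a permutation $\sigma\in S_n$ of $[n]$, let $a^\sigma$ be the partition obtained from $a$ by replacing $x$ by $\sigma(x)$ and $y'$ by $\sigma(y)'$ in each block of $a$. **Theorem.** Every $\mathfrak n$-conjugacy class of $\mathcal P_n$ contains an element in $\mathfrak n$-normal form. Moreover, if $a,b\in\mathcal P_n$ are in $\mathfrak n$-normal form, then $a\sim_{\mathfrak n}b$ if and only if $b=a^\sigma$ for some $\sigma\in S_n$. -/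

import Mathlib

/-- Elements `a`, `b` of a monoid are naturally conjugate if there are conjugators `g`, `h` with
`a g = g b`, `b h = h a`, `h a g = b` and `g b h = a`. -/
def NaturallyConj {M : Type*} [Monoid M] (a b : M) : Prop :=
  ∃ g h : M, a * g = g * b ∧ b * h = h * a ∧ h * a * g = b ∧ g * b * h = a

/-- The natural conjugacy class of `a`. -/
def natConjClass {M : Type*} [Monoid M] (a : M) : Set M :=
  {b | NaturallyConj b a}

/-- An element of the partition monoid on `X`: a partition of `X ⊔ X'`, i.e. an equivalence
relation on `X ⊕ X`. The vertex `x` of the upper row is `Sum.inl x`, the vertex `x'` of the lower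
row is `Sum.inr x`. -/
@[ext]
structure PartitionMonoid (X : Type*) where
  toSetoid : Setoid (X ⊕ X)

namespace PartitionMonoid

variable {X : Type*}

/-- The inclusion of the upper and middle rows into the three rows (top, middle, bottom). -/
def topMid : X ⊕ X → X ⊕ (X ⊕ X) := Sum.map id Sum.inl

/-- The inclusion of the middle and bottom rows into the three rows. -/
def midBot : X ⊕ X → X ⊕ (X ⊕ X) := Sum.inr

/-- The inclusion of the top and bottom rows into the three rows. -/
def topBot : X ⊕ X → X ⊕ (X ⊕ X) := Sum.map id Sum.inr

/-- The partition of the three rows obtained by drawing `a` over `b` and gluing the lower row of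
`a` to the upper row of `b`. -/
def stack (a b : PartitionMonoid X) : Setoid (X ⊕ (X ⊕ X)) :=
  a.toSetoid.map topMid ⊔ b.toSetoid.map midBot

/-- The product: draw `a` over `b`, glue, and remove the middle row. -/
instance : Mul (PartitionMonoid X) where
  mul a b := ⟨(stack a b).comap topBot⟩

/-- The identity has the blocks `{x, x'}`. -/
instance : One (PartitionMonoid X) where
  one := ⟨Setoid.ker (Sum.elim id id)⟩

theorem toSetoid_mul (a b : PartitionMonoid X) :
    (a * b).toSetoid = (stack a b).comap topBot := rfl

theorem toSetoid_one : (1 : PartitionMonoid X).toSetoid = Setoid.ker (Sum.elim id id) := rfl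

theorem map_le_iff {Y Z : Type*} {r : Setoid Y} {f : Y → Z} {s : Setoid Z} :
    r.map f ≤ s ↔ r ≤ s.comap f := by
  constructor
  · intro h x y hxy
    exact h (Setoid.le_comap_map hxy)
  · intro h
    refine Setoid.eqvGen_le ?_
    rintro x y ⟨u, v, huv, rfl, rfl⟩
    exact h huv

theorem map_mono {Y Z : Type*} {r s : Setoid Y} (f : Y → Z) (h : r ≤ s) : r.map f ≤ s.map f :=
  map_le_iff.2 (h.trans Setoid.le_comap_map)

theorem map_sup {Y Z : Type*} (r s : Setoid Y) (f : Y → Z) :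
    (r ⊔ s).map f = r.map f ⊔ s.map f := by
  refine le_antisymm (map_le_iff.2 (sup_le ?_ ?_))
    (sup_le (map_mono f le_sup_left) (map_mono f le_sup_right))
  · exact map_le_iff.1 le_sup_left
  · exact map_le_iff.1 le_sup_right

theorem map_map {Y Z W : Type*} (r : Setoid Y) (f : Y → Z) (g : Z → W) :
    (r.map f).map g = r.map (g ∘ f) := by
  refine le_antisymm (map_le_iff.2 (map_le_iff.2 ?_)) (map_le_iff.2 ?_)
  · rw [← Setoid.comap_comp]; exact Setoid.le_comap_map
  · rw [Setoid.comap_comp]; exact map_le_iff.1 (map_le_iff.1 le_rfl)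

theorem map_rel_of_injective {Y Z : Type*} {r : Setoid Y} {f : Y → Z}
    (hf : Function.Injective f) {u v : Z} (h : r.map f u v) :
    u = v ∨ ∃ x y, f x = u ∧ f y = v ∧ r x y := by
  induction h with
  | rel u v h =>
    obtain ⟨x, y, hxy, hx, hy⟩ := h
    exact Or.inr ⟨x, y, hx, hy, hxy⟩
  | refl u => exact Or.inl rfl
  | symm u v _ ih =>
    rcases ih with h | ⟨x, y, hx, hy, hxy⟩
    · exact Or.inl h.symm
    · exact Or.inr ⟨y, x, hy, hx, r.symm hxy⟩
  | trans u v w _ _ ih1 ih2 =>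
    rcases ih1 with rfl | ⟨x, y, hx, hy, hxy⟩
    · exact ih2
    · rcases ih2 with rfl | ⟨x', y', hx', hy', hxy'⟩
      · exact Or.inr ⟨x, y, hx, hy, hxy⟩
      · obtain rfl := hf (hy.trans hx'.symm)
        exact Or.inr ⟨x, y', hx, hy', r.trans hxy hxy'⟩

theorem comap_sup_map {Y B : Type*} (R : Setoid Y) (s : Setoid B) (i : B → Y) :
    (R ⊔ s.map i).comap i = R.comap i ⊔ s := by
  refine le_antisymm ?_ (sup_le (fun x y h => ?_) ?_)
  · set K := R.comap i ⊔ s with hK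
    let P : Y → Set B := fun u => {w | ∃ z, R (i z) u ∧ K z w}
    have hRK : ∀ {x y}, R (i x) (i y) → K x y := fun {x y} h =>
      (le_sup_left : R.comap i ≤ K) h
    have hsK : ∀ {x y}, s x y → K x y := fun {x y} h => (le_sup_right : s ≤ K) h
    have hP : ∀ z, P (i z) = {w | K z w} := by
      intro z
      ext w
      constructor
      · rintro ⟨z', h1, h2⟩
        exact K.trans (K.symm (hRK h1)) h2
      · intro h
        exact ⟨z, R.refl _, h⟩
    have key : R ⊔ s.map i ≤ Setoid.ker P := by
      refine sup_le ?_ (map_le_iff.2 ?_)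
      · intro u v huv
        change P u = P v
        ext w
        constructor
        · rintro ⟨z, h1, h2⟩; exact ⟨z, R.trans h1 huv, h2⟩
        · rintro ⟨z, h1, h2⟩; exact ⟨z, R.trans h1 (R.symm huv), h2⟩
      · intro u v huv
        change P (i u) = P (i v)
        rw [hP, hP]
        ext w
        exact ⟨fun h => K.trans (K.symm (hsK huv)) h, fun h => K.trans (hsK huv) h⟩
    intro x y h
    have h1 : P (i x) = P (i y) := key h
    rw [hP, hP] at h1
    have h2 : y ∈ {w | K y w} := K.refl y
    rw [← h1] at h2
    exact h2
  · exact (le_sup_left : R ≤ R ⊔ s.map i) h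
  · exact map_le_iff.1 le_sup_right

theorem comap_map_eq_map_comap {A B C D : Type*} (r : Setoid B) (f : B → D) (e : C → D)
    (g : A → B) (k : A → C) (hf : Function.Injective f) (he : Function.Injective e)
    (hc : ∀ x, f (g x) = e (k x)) (hp : ∀ b c, f b = e c → ∃ x, g x = b ∧ k x = c) :
    (r.map f).comap e = (r.comap g).map k := by
  refine le_antisymm ?_ (map_le_iff.2 ?_)
  · intro u v h
    rcases map_rel_of_injective hf h with h | ⟨x, y, hx, hy, hxy⟩
    · rw [he h]
    · obtain ⟨x', rfl, rfl⟩ := hp _ _ hx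
      obtain ⟨y', rfl, rfl⟩ := hp _ _ hy
      exact Setoid.le_comap_map (r := r.comap g) (f := k) hxy
  · intro u v h
    change r.map f (e (k u)) (e (k v))
    rw [← hc, ← hc]
    exact Setoid.le_comap_map (r := r) (f := f) h

/-- Both ways of bracketing a triple product arise from the stack of four rows. -/
theorem mul_assoc_left (a b c : PartitionMonoid X) :
    (a * b * c).toSetoid =
      ((a.toSetoid.map (Sum.map id Sum.inl) ⊔ b.toSetoid.map (Sum.inr ∘ Sum.map id Sum.inl)) ⊔
        c.toSetoid.map (Sum.inr ∘ Sum.inr) : Setoid (X ⊕ (X ⊕ (X ⊕ X)))).comap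
        (Sum.map id (Sum.inr ∘ Sum.inr)) := by
  have h1 : (a.toSetoid.map (Sum.map id Sum.inl) ⊔
      b.toSetoid.map (Sum.inr ∘ Sum.map id Sum.inl) : Setoid (X ⊕ (X ⊕ (X ⊕ X)))) =
      (stack a b).map (Sum.map id (Sum.map id Sum.inl)) := by
    rw [stack, map_sup, map_map, map_map]
    congr 2
    ext x
    rcases x with x | x <;> rfl
  have h2 : (c.toSetoid.map (Sum.inr ∘ Sum.inr) : Setoid (X ⊕ (X ⊕ (X ⊕ X)))) =
      (c.toSetoid.map midBot).map (Sum.map id Sum.inr) := by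
    rw [map_map]; rfl
  have h3 : (Sum.map id (Sum.inr ∘ Sum.inr) : X ⊕ X → X ⊕ (X ⊕ (X ⊕ X))) =
      Sum.map id Sum.inr ∘ topBot := by
    ext x
    rcases x with x | x <;> rfl
  rw [h1, h2, h3, Setoid.comap_comp, comap_sup_map,
    comap_map_eq_map_comap (stack a b) _ _ topBot topMid]
  · rfl
  · exact Function.Injective.sumMap Function.injective_id
      (Function.Injective.sumMap Function.injective_id Sum.inl_injective)
  · exact Function.Injective.sumMap Function.injective_id Sum.inr_injective
  · rintro (x | x) <;> rfl
  · rintro (x | x | x) (y | y | y) h <;> simp [topBot, topMid] at h ⊢ <;> exact h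

theorem mul_assoc_right (a b c : PartitionMonoid X) :
    (a * (b * c)).toSetoid =
      ((a.toSetoid.map (Sum.map id Sum.inl) ⊔ b.toSetoid.map (Sum.inr ∘ Sum.map id Sum.inl)) ⊔
        c.toSetoid.map (Sum.inr ∘ Sum.inr) : Setoid (X ⊕ (X ⊕ (X ⊕ X)))).comap
        (Sum.map id (Sum.inr ∘ Sum.inr)) := by
  have h1 : (b.toSetoid.map (Sum.inr ∘ Sum.map id Sum.inl) ⊔
      c.toSetoid.map (Sum.inr ∘ Sum.inr) : Setoid (X ⊕ (X ⊕ (X ⊕ X)))) =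
      (stack b c).map Sum.inr := by
    rw [stack, map_sup, map_map, map_map]
    rfl
  have h2 : (a.toSetoid.map (Sum.map id Sum.inl) : Setoid (X ⊕ (X ⊕ (X ⊕ X)))) =
      (a.toSetoid.map topMid).map (Sum.map id topBot) := by
    rw [map_map]
    congr 1
    ext x
    rcases x with x | x <;> rfl
  have h3 : (Sum.map id (Sum.inr ∘ Sum.inr) : X ⊕ X → X ⊕ (X ⊕ (X ⊕ X))) =
      Sum.map id topBot ∘ topBot := by
    ext x
    rcases x with x | x <;> rfl
  have hinj : Function.Injective (topBot : X ⊕ X → X ⊕ (X ⊕ X)) :=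
    Function.Injective.sumMap Function.injective_id Sum.inr_injective
  rw [sup_assoc, h1, h2, h3, Setoid.comap_comp, sup_comm, comap_sup_map,
    comap_map_eq_map_comap (stack b c) _ _ topBot midBot, sup_comm]
  · rfl
  · exact Sum.inr_injective
  · exact Function.Injective.sumMap Function.injective_id hinj
  · rintro (x | x) <;> rfl
  · rintro (x | x | x) (y | y | y) h <;> simp [topBot, midBot] at h ⊢ <;>
      first | exact h | exact h.symm

theorem one_mul_toSetoid (a : PartitionMonoid X) : (1 * a).toSetoid = a.toSetoid := by
  refine le_antisymm ?_ ?_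
  · have key : stack 1 a ≤ a.toSetoid.comap (Sum.elim Sum.inl id) := by
      refine sup_le (map_le_iff.2 ?_) (map_le_iff.2 ?_)
      · rintro (x | x) (y | y) h <;>
        · obtain rfl : x = y := h
          exact a.toSetoid.refl _
      · intro u v h
        exact h
    rintro (x | x) (y | y) h <;> exact key h
  · have hid : ∀ u : X ⊕ X, stack 1 a (topBot u) (midBot u) := by
      rintro (x | x)
      · refine (le_sup_left : _ ≤ stack 1 a) ?_
        exact Setoid.le_comap_map (r := (1 : PartitionMonoid X).toSetoid) (f := topMid)
          (show (1 : PartitionMonoid X).toSetoid (Sum.inl x) (Sum.inr x) from rfl)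
      · exact (stack 1 a).refl _
    intro u v h
    refine (stack 1 a).trans (hid u) ((stack 1 a).trans ?_ ((stack 1 a).symm (hid v)))
    exact (le_sup_right : _ ≤ stack 1 a) (Setoid.le_comap_map (f := midBot) h)

theorem mul_one_toSetoid (a : PartitionMonoid X) : (a * 1).toSetoid = a.toSetoid := by
  refine le_antisymm ?_ ?_
  · have key : stack a 1 ≤ a.toSetoid.comap (Sum.elim Sum.inl (Sum.elim Sum.inr Sum.inr)) := by
      refine sup_le (map_le_iff.2 ?_) (map_le_iff.2 ?_)
      · rintro (x | x) (y | y) h <;> exact h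
      · rintro (x | x) (y | y) h <;>
        · obtain rfl : x = y := h
          exact a.toSetoid.refl _
    rintro (x | x) (y | y) h <;> exact key h
  · have hid : ∀ u : X ⊕ X, stack a 1 (topBot u) (topMid u) := by
      rintro (x | x)
      · exact (stack a 1).refl _
      · refine (le_sup_right : _ ≤ stack a 1) ?_
        exact Setoid.le_comap_map (r := (1 : PartitionMonoid X).toSetoid) (f := midBot)
          (show (1 : PartitionMonoid X).toSetoid (Sum.inr x) (Sum.inl x) from rfl)
    intro u v h
    refine (stack a 1).trans (hid u) ((stack a 1).trans ?_ ((stack a 1).symm (hid v)))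
    exact (le_sup_left : _ ≤ stack a 1) (Setoid.le_comap_map (f := topMid) h)

/-- The partition monoid on `X`. -/
instance : Monoid (PartitionMonoid X) where
  mul_assoc a b c := PartitionMonoid.ext ((mul_assoc_left a b c).trans (mul_assoc_right a b c).symm)
  one_mul a := PartitionMonoid.ext (one_mul_toSetoid a)
  mul_one a := PartitionMonoid.ext (mul_one_toSetoid a)

/-- The blocks of `a`. -/
def blocks (a : PartitionMonoid X) : Set (Set (X ⊕ X)) := a.toSetoid.classes

/-- The kernel of `a`, as an equivalence relation on `X`. -/
def ker (a : PartitionMonoid X) : Setoid X := a.toSetoid.comap Sum.inl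

/-- The cokernel of `a`, transported to `X` by dropping the primes. -/
def coker (a : PartitionMonoid X) : Setoid X := a.toSetoid.comap Sum.inr

/-- `a` is connected if the join of its kernel and cokernel is the universal relation. -/
def IsConnected (a : PartitionMonoid X) : Prop := a.ker ⊔ a.coker = ⊤

/-- A set of vertices is transversal if it meets both rows. -/
def IsTransversal (s : Set (X ⊕ X)) : Prop := (∃ x, Sum.inl x ∈ s) ∧ ∃ x, Sum.inr x ∈ s

def IsTransversalFree (a : PartitionMonoid X) : Prop := ∀ s ∈ a.blocks, ¬ IsTransversal s

/-- `a` has exactly one transversal block. -/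
def IsOneTransversal (a : PartitionMonoid X) : Prop := ∃! s, s ∈ a.blocks ∧ IsTransversal s

/-- The subpartition `b_A` of `b` induced by `A`, an element of the partition monoid on `A`. -/
def subpartition (b : PartitionMonoid X) (A : Set X) : PartitionMonoid A :=
  ⟨b.toSetoid.comap (Sum.map Subtype.val Subtype.val)⟩

/-- The set `A` of vertices of the upper row. -/
def upper (A : Set X) : Set (X ⊕ X) := Sum.inl '' A

/-- The set `A'` of vertices of the lower row. -/
def lower (A : Set X) : Set (X ⊕ X) := Sum.inr '' A

/-- `s_A = s ∩ (A ∪ A')`. For a block `s` of `b` this is, if nonempty, a block of `b_A`, written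
here as a set of vertices of `X ⊔ X'`. -/
def trace (s : Set (X ⊕ X)) (A : Set X) : Set (X ⊕ X) := s ∩ (upper A ∪ lower A)

/-- `b` is in `n`-normal form. The subpartition `b_A` is nontrivial when `A` has at least two
elements. -/
def IsNormalForm (b : PartitionMonoid X) : Prop :=
  (∀ A : Set X, A.Nontrivial → (b.subpartition A).IsConnected →
    (b.subpartition A).IsTransversalFree →
    ∃ s ∈ b.blocks, ∃ t ∈ b.blocks, (trace s A).Nonempty ∧ (trace t A).Nonempty ∧
      trace s A ≠ trace t A ∧ trace s A ≠ s ∧ trace t A ≠ t ∧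
      ((trace s A ⊆ upper A ∧ trace t A ⊆ upper A) ∨
        (trace s A ⊆ lower A ∧ trace t A ⊆ lower A))) ∧
  (∀ A : Set X, A.Nontrivial → (b.subpartition A).IsConnected →
    (b.subpartition A).IsOneTransversal →
    ∀ s ∈ b.blocks, IsTransversal (trace s A) →
      ∃ t ∈ b.blocks, (trace t A).Nonempty ∧ trace t A ≠ trace s A ∧ t ≠ trace t A)

/-- `a^σ`: replace `x` by `σ x` and `y'` by `(σ y)'` in each block of `a`. Thus `u` and `v` lie in
the same block of `a^σ` iff their preimages under `σ` lie in the same block of `a`. -/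
def permute (a : PartitionMonoid X) (σ : Equiv.Perm X) : PartitionMonoid X :=
  ⟨a.toSetoid.comap (Sum.map σ.symm σ.symm)⟩

end PartitionMonoid

/-!
Both halves of the theorem rest on one notion. Call a set `A` of points *collapsible* for `a` if its
upper row meets at most one block of `a` not contained in that row, and likewise its lower row
(`IsCollapsible`). The two conditions in the definition of normal form together say that no
connected `A` with at least two points is collapsible (`isNormalForm_iff`): a transversal of `a_A`,
if there is one, must be the exceptional block of both rows.

Existence. If `g * h * a = a = a * (g * h)`, then `a` is naturally conjugate to `h * a * g`. For a
connected collapsible `A`, let `g` be the identity off `A`, keep the blocks of `a` lying in the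
upper row of `A`, and join the exceptional block to a single lower point `p'` with `p ∈ A`; let `h`
be obtained in the same way from the lower row, upside down. Then `g * h` fixes `a` on both sides:
connectedness of `A` joins all middle vertices in `A`, so the exceptional blocks are put back in
place, while the other blocks are inserted by `g` and `h` themselves
(`collapse_mul_flip_collapse_mul`). The conjugate `h * a * g` has smaller support, because
the points of `A` other than `p` have become isolated (`support_collapse_ssubset`), so the process ends in a
normal form.

Uniqueness. Finiteness allows the conjugators `g`, `h` to be chosen with `e = g * h` and
`f = h * g` idempotent (`exists_idempotent_conjugators`). As `e` is idempotent, every class of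
`ker e ⊔ coker e` meets at most one transversal of `e`, and since `e * a = a = a * e` this makes the
class connected and collapsible for `a`. Hence, if `a` is in normal form, the classes are trivial
and `e` is a partial identity (`eq_of_ker_sup_coker`). The same holds for `f` if `b` is in normal
form, so `g` and `h` are mutually inverse partial bijections as far as the supports of `a` and `b`
are concerned (`exists_partner`), and any permutation `σ` extending them satisfies `b = a^σ`
(`eq_permute_of_conj`).
-/

namespace PartitionMonoid

variable {X : Type*}

/-! ### Relations in a product -/

/-- A labelling of the three rows which is constant along the blocks of `a` and of `b` is constant
along the blocks of `a * b`. -/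
theorem label_eq_of_mul {a b : PartitionMonoid X} {T : Type*} (t m l : X → T)
    (ha : ∀ u v, a.toSetoid u v → Sum.elim t m u = Sum.elim t m v)
    (hb : ∀ u v, b.toSetoid u v → Sum.elim m l u = Sum.elim m l v)
    (u v : X ⊕ X) (h : (a * b).toSetoid u v) : Sum.elim t l u = Sum.elim t l v := by
  have key : stack a b ≤ Setoid.ker (Sum.elim t (Sum.elim m l)) := by
    refine sup_le (map_le_iff.2 fun u v h => ?_) (map_le_iff.2 fun u v h => ?_)
    · have := ha u v h
      rcases u with u | u <;> rcases v with v | v <;> exact this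
    · exact hb u v h
  have h' := key h
  rcases u with u | u <;> rcases v with v | v <;> exact h'

theorem stack_topMid {a : PartitionMonoid X} (b : PartitionMonoid X) {u v : X ⊕ X}
    (h : a.toSetoid u v) : stack a b (topMid u) (topMid v) :=
  (le_sup_left : _ ≤ stack a b) (Setoid.le_comap_map (f := topMid) h)

theorem stack_midBot (a : PartitionMonoid X) {b : PartitionMonoid X} {u v : X ⊕ X}
    (h : b.toSetoid u v) : stack a b (midBot u) (midBot v) :=
  (le_sup_right : _ ≤ stack a b) (Setoid.le_comap_map (f := midBot) h)

theorem ker_le_ker_mul (a b : PartitionMonoid X) : a.ker ≤ (a * b).ker :=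
  fun _ _ h => stack_topMid b h

theorem coker_le_coker_mul (a b : PartitionMonoid X) : b.coker ≤ (a * b).coker :=
  fun _ _ h => stack_midBot a h

theorem stack_mid_of_sup {a b : PartitionMonoid X} {x y : X} (h : (a.coker ⊔ b.ker) x y) :
    stack a b (Sum.inr (Sum.inl x)) (Sum.inr (Sum.inl y)) := by
  have : a.coker ⊔ b.ker ≤ (stack a b).comap (Sum.inr ∘ Sum.inl) :=
    sup_le (fun _ _ h => stack_topMid b h) (fun _ _ h => stack_midBot a h)
  exact this h

/-- A vertex of the upper row of `a * b` lies in the block of a vertex of the lower row exactly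
when it is joined to it by a transversal of `a`, a walk in the middle row, and a transversal
of `b`. -/
theorem mul_inl_inr_iff {a b : PartitionMonoid X} {x y : X} :
    (a * b).toSetoid (Sum.inl x) (Sum.inr y) ↔ ∃ z w, a.toSetoid (Sum.inl x) (Sum.inr z) ∧
      (a.coker ⊔ b.ker) z w ∧ b.toSetoid (Sum.inl w) (Sum.inr y) := by
  constructor
  · intro h
    set R := a.coker ⊔ b.ker with hR
    have hc : ∀ {x y}, a.toSetoid (Sum.inr x) (Sum.inr y) → R x y := fun h =>
      (le_sup_left : a.coker ≤ R) h
    have hk : ∀ {x y}, b.toSetoid (Sum.inl x) (Sum.inl y) → R x y := fun h =>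
      (le_sup_right : b.ker ≤ R) h
    -- Label each vertex by the set of middle vertices its block reaches.
    have key := label_eq_of_mul (a := a) (b := b)
      (fun x => {w | ∃ z, a.toSetoid (Sum.inl x) (Sum.inr z) ∧ R z w})
      (fun x => {w | R x w})
      (fun x => {w | ∃ z, b.toSetoid (Sum.inl z) (Sum.inr x) ∧ R z w}) ?_ ?_ _ _ h
    · -- Otherwise the block of `y` in the lower row of `b` is a block of the product.
      have hy : ∃ z, b.toSetoid (Sum.inl z) (Sum.inr y) := by
        by_contra hn
        push Not at hn
        have hl := label_eq_of_mul (a := a) (b := b) (fun _ => False) (fun _ => False)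
          (fun w => b.toSetoid (Sum.inr w) (Sum.inr y)) ?_ ?_ _ _ h
        · simp only [Sum.elim_inl, Sum.elim_inr, eq_iff_iff] at hl
          exact hl.2 (b.toSetoid.refl _)
        · rintro (u | u) (v | v) _ <;> rfl
        · rintro (u | u) (v | v) huv
          · rfl
          · simpa using fun h' => hn _ (b.toSetoid.trans huv h')
          · simpa using fun h' => hn _ (b.toSetoid.trans (b.toSetoid.symm huv) h')
          · simpa using ⟨b.toSetoid.trans (b.toSetoid.symm huv), b.toSetoid.trans huv⟩
      obtain ⟨w, hw⟩ := hy
      have hmem : w ∈ {w | ∃ z, b.toSetoid (Sum.inl z) (Sum.inr y) ∧ R z w} :=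
        ⟨w, hw, R.refl _⟩
      simp only [Sum.elim_inl, Sum.elim_inr] at key
      rw [← key] at hmem
      obtain ⟨z, hz, hzw⟩ := hmem
      exact ⟨z, w, hz, hzw, hw⟩
    · rintro (u | u) (v | v) huv <;> ext w
      · exact ⟨fun ⟨z, h1, h2⟩ => ⟨z, a.toSetoid.trans (a.toSetoid.symm huv) h1, h2⟩,
          fun ⟨z, h1, h2⟩ => ⟨z, a.toSetoid.trans huv h1, h2⟩⟩
      · exact ⟨fun ⟨z, h1, h2⟩ => R.trans (hc (a.toSetoid.trans (a.toSetoid.symm huv) h1)) h2,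
          fun h1 => ⟨v, huv, h1⟩⟩
      · exact ⟨fun h1 => ⟨u, a.toSetoid.symm huv, h1⟩,
          fun ⟨z, h1, h2⟩ => R.trans (hc (a.toSetoid.trans huv h1)) h2⟩
      · exact ⟨R.trans (R.symm (hc huv)), R.trans (hc huv)⟩
    · rintro (u | u) (v | v) huv <;> ext w
      · exact ⟨R.trans (R.symm (hk huv)), R.trans (hk huv)⟩
      · exact ⟨fun h1 => ⟨u, huv, h1⟩, fun ⟨z, h1, h2⟩ =>
          R.trans (hk (b.toSetoid.trans huv (b.toSetoid.symm h1))) h2⟩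
      · exact ⟨fun ⟨z, h1, h2⟩ => R.trans (hk (b.toSetoid.trans (b.toSetoid.symm huv)
          (b.toSetoid.symm h1))) h2, fun h1 => ⟨v, b.toSetoid.symm huv, h1⟩⟩
      · exact ⟨fun ⟨z, h1, h2⟩ => ⟨z, b.toSetoid.trans h1 huv, h2⟩,
          fun ⟨z, h1, h2⟩ => ⟨z, b.toSetoid.trans h1 (b.toSetoid.symm huv), h2⟩⟩
  · rintro ⟨z, w, h1, h2, h3⟩
    exact (stack a b).trans (stack_topMid b h1)
      ((stack a b).trans (stack_mid_of_sup h2) (stack_midBot a h3))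

/-- A block of `a` contained in the upper row is a block of `a * b`. -/
theorem mul_rel_of_forall_not {a b : PartitionMonoid X} {x : X}
    (hx : ∀ z, ¬ a.toSetoid (Sum.inl x) (Sum.inr z)) {v : X ⊕ X}
    (h : (a * b).toSetoid (Sum.inl x) v) : a.toSetoid (Sum.inl x) v := by
  have key := label_eq_of_mul (a := a) (b := b) (fun y => a.toSetoid (Sum.inl x) (Sum.inl y))
    (fun _ => False) (fun _ => False) ?_ ?_ _ _ h
  · have h' := key.mp (a.toSetoid.refl _)
    rcases v with v | v
    · exact h'
    · exact h'.elim
  · rintro (u | u) (v | v) huv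
    · exact propext ⟨fun h => a.toSetoid.trans h huv,
        fun h => a.toSetoid.trans h (a.toSetoid.symm huv)⟩
    · exact eq_false fun h => hx _ (a.toSetoid.trans h huv)
    · exact (eq_false fun h => hx _ (a.toSetoid.trans h (a.toSetoid.symm huv))).symm
    · rfl
  · rintro (u | u) (v | v) _ <;> rfl

/-! ### Reflection in the horizontal axis -/

/-- The partition obtained by exchanging the two rows. -/
def flip (a : PartitionMonoid X) : PartitionMonoid X := ⟨a.toSetoid.comap Sum.swap⟩

@[simp] theorem flip_flip (a : PartitionMonoid X) : a.flip.flip = a := by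
  ext u v
  change a.toSetoid u.swap.swap v.swap.swap ↔ _
  rw [Sum.swap_swap, Sum.swap_swap]

theorem flip_rel {a : PartitionMonoid X} {u v : X ⊕ X} :
    a.flip.toSetoid u v ↔ a.toSetoid u.swap v.swap := Iff.rfl

theorem flip_mul_le (a b : PartitionMonoid X) :
    (a * b).toSetoid ≤ (b.flip * a.flip).flip.toSetoid := by
  have key : stack a b ≤ (stack b.flip a.flip).comap
      (Sum.elim (Sum.inr ∘ Sum.inr) (Sum.elim (Sum.inr ∘ Sum.inl) Sum.inl)) := by
    refine sup_le (map_le_iff.2 fun u v h => ?_) (map_le_iff.2 fun u v h => ?_)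
    · have h' : stack b.flip a.flip (midBot u.swap) (midBot v.swap) := stack_midBot _ (by
        rw [flip_rel, Sum.swap_swap, Sum.swap_swap]; exact h)
      rcases u with u | u <;> rcases v with v | v <;> exact h'
    · have h' : stack b.flip a.flip (topMid u.swap) (topMid v.swap) := stack_topMid _ (by
        rw [flip_rel, Sum.swap_swap, Sum.swap_swap]; exact h)
      rcases u with u | u <;> rcases v with v | v <;> exact h'
  intro u v h
  have h' := key h
  rcases u with u | u <;> rcases v with v | v <;> exact h'

@[simp] theorem flip_mul (a b : PartitionMonoid X) : (a * b).flip = b.flip * a.flip := by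
  refine PartitionMonoid.ext (le_antisymm ?_ ?_)
  · intro u v h
    have := flip_mul_le a b h
    simpa [flip_rel] using this
  · simpa using flip_mul_le b.flip a.flip

/-! ### Natural conjugacy -/

theorem naturallyConj_of_mul_eq {M : Type*} [Monoid M] {a g h : M} (h1 : g * h * a = a)
    (h2 : a * (g * h) = a) : NaturallyConj a (h * a * g) := by
  refine ⟨g, h, ?_, ?_, rfl, ?_⟩
  · rw [← mul_assoc, ← mul_assoc, h1]
  · rw [mul_assoc, mul_assoc, h2]
  · rw [← mul_assoc, ← mul_assoc, h1, mul_assoc, h2]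

theorem _root_.NaturallyConj.symm {M : Type*} [Monoid M] {a b : M} (h : NaturallyConj a b) :
    NaturallyConj b a := by
  obtain ⟨g, k, h1, h2, h3, h4⟩ := h
  exact ⟨k, g, h2, h1, h4, h3⟩

theorem _root_.NaturallyConj.trans {M : Type*} [Monoid M] {a b c : M} (h : NaturallyConj a b)
    (h' : NaturallyConj b c) : NaturallyConj a c := by
  obtain ⟨g, k, h1, h2, h3, h4⟩ := h
  obtain ⟨g', k', h1', h2', h3', h4'⟩ := h'
  refine ⟨g * g', k' * k, ?_, ?_, ?_, ?_⟩
  · rw [← mul_assoc, h1, mul_assoc, h1', mul_assoc]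
  · rw [← mul_assoc, h2', mul_assoc, h2, mul_assoc]
  · rw [← h3', ← h3]; simp only [mul_assoc]
  · rw [← h4, ← h4']; simp only [mul_assoc]

theorem exists_pow_isIdempotentElem {M : Type*} [Monoid M] [Finite M] (x : M) :
    ∃ m, IsIdempotentElem (x ^ (m + 1)) := by
  obtain ⟨i, j, hij, h⟩ := Finite.exists_ne_map_eq_of_infinite (fun n : ℕ => x ^ (n + 1))
  wlog hlt : i < j generalizing i j
  · exact this j i hij.symm h.symm (by omega)
  set p := j - i with hp
  have hj : j = i + p := by omega
  have step : ∀ k, ∀ n, i + 1 ≤ n → x ^ (n + k * p) = x ^ n := by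
    intro k
    induction k with
    | zero => simp
    | succ k ih =>
      intro n hn
      obtain ⟨c, rfl⟩ := Nat.exists_eq_add_of_le hn
      have : i + 1 + c + (k + 1) * p = (j + 1) + c + k * p := by rw [hj]; ring
      rw [this, ih _ (by omega), pow_add, ← h, ← pow_add]
  -- The exponent `(i + 1) * p` is a multiple of the period and lies beyond the preperiod.
  refine ⟨(i + 1) * p - 1, ?_⟩
  have hpos : i + 1 ≤ (i + 1) * p := Nat.le_mul_of_pos_right _ (by omega)
  have e : (i + 1) * p - 1 + 1 = (i + 1) * p := by omega
  rw [e, IsIdempotentElem, ← pow_add, step _ _ hpos]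

/-- In a finite monoid the conjugators of naturally conjugate elements can be chosen with both
products idempotent. -/
theorem exists_idempotent_conjugators {M : Type*} [Monoid M] [Finite M] {a b : M}
    (hab : NaturallyConj a b) : ∃ g h : M, IsIdempotentElem (g * h) ∧ IsIdempotentElem (h * g) ∧
      g * h * a = a ∧ a * (g * h) = a ∧ h * g * b = b ∧ b * (h * g) = b ∧
      h * a * g = b ∧ g * b * h = a := by
  obtain ⟨g, h, h1, h2, h3, h4⟩ := hab
  have ga : g * h * a = a := by rw [mul_assoc, ← h2, ← mul_assoc, h4]
  have ag : a * (g * h) = a := by rw [← mul_assoc, h1, h4]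
  have gb : h * g * b = b := by rw [mul_assoc, ← h1, ← mul_assoc, h3]
  have bg : b * (h * g) = b := by rw [← mul_assoc, h2, h3]
  -- Working in `M × M` gives one exponent for both products.
  obtain ⟨m, hm⟩ := exists_pow_isIdempotentElem ((g * h, h * g) : M × M)
  have hm1 : IsIdempotentElem ((g * h) ^ (m + 1)) := congrArg Prod.fst hm
  have hm2 : IsIdempotentElem ((h * g) ^ (m + 1)) := congrArg Prod.snd hm
  have pl : ∀ (e c : M), e * c = c → ∀ n, e ^ n * c = c := by
    intro e c hc n
    induction n with
    | zero => simp
    | succ n ih => rw [pow_succ, mul_assoc, hc, ih]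
  have pr : ∀ (e c : M), c * e = c → ∀ n, c * e ^ n = c := by
    intro e c hc n
    induction n with
    | zero => simp
    | succ n ih => rw [pow_succ, ← mul_assoc, ih, hc]
  have e1 : g * (h * (g * h) ^ m) = (g * h) ^ (m + 1) := by rw [← mul_assoc, ← pow_succ']
  have e2 : h * (g * h) ^ m * g = (h * g) ^ (m + 1) := by
    have comm : ∀ n, (g * h) ^ n * g = g * (h * g) ^ n := by
      intro n
      induction n with
      | zero => simp
      | succ n ih => rw [pow_succ', mul_assoc, ih, pow_succ']; simp only [mul_assoc]
    rw [mul_assoc, comm, ← mul_assoc, ← pow_succ']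
  refine ⟨g, h * (g * h) ^ m, ?_, ?_, ?_, ?_, ?_, ?_, ?_, ?_⟩
  · rw [e1]; exact hm1
  · rw [e2]; exact hm2
  · rw [e1, pl _ _ ga]
  · rw [e1, pr _ _ ag]
  · rw [e2, pl _ _ gb]
  · rw [e2, pr _ _ bg]
  · rw [mul_assoc h, pl _ _ ga, h3]
  · rw [← mul_assoc, h4, pr _ _ ag]

/-! ### Collapsible sets -/

/-- Each of the two rows of `A` meets at most one block of `a` that is not contained in that row of
`A`: in the upper row the block of some chosen `u ∈ A`, in the lower row that of `l ∈ A`. -/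
def IsCollapsible (a : PartitionMonoid X) (A : Set X) : Prop :=
  ∃ u ∈ A, ∃ l ∈ A,
    (∀ x ∈ A, ¬ a.toSetoid (Sum.inl x) (Sum.inl u) →
      ∀ v, a.toSetoid (Sum.inl x) v → v ∈ upper A) ∧
    (∀ x ∈ A, ¬ a.toSetoid (Sum.inr x) (Sum.inr l) →
      ∀ v, a.toSetoid (Sum.inr x) v → v ∈ lower A)

theorem inl_mem_upper {A : Set X} {x : X} : Sum.inl x ∈ upper A ↔ x ∈ A := by
  simp [upper]

theorem inr_mem_lower {A : Set X} {x : X} : Sum.inr x ∈ lower A ↔ x ∈ A := by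
  simp [lower]

theorem inl_not_mem_lower {A : Set X} {x : X} : Sum.inl x ∉ lower A := by
  simp [lower]

theorem inr_not_mem_upper {A : Set X} {x : X} : Sum.inr x ∉ upper A := by
  simp [upper]

theorem mem_trace {s : Set (X ⊕ X)} {A : Set X} {v : X ⊕ X} :
    v ∈ trace s A ↔ v ∈ s ∧ (v ∈ upper A ∨ v ∈ lower A) := Iff.rfl

theorem mem_trace_inl {s : Set (X ⊕ X)} {A : Set X} {x : X} :
    Sum.inl x ∈ trace s A ↔ Sum.inl x ∈ s ∧ x ∈ A := by
  simp [mem_trace, inl_mem_upper, inl_not_mem_lower]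

theorem mem_trace_inr {s : Set (X ⊕ X)} {A : Set X} {x : X} :
    Sum.inr x ∈ trace s A ↔ Sum.inr x ∈ s ∧ x ∈ A := by
  simp [mem_trace, inr_mem_lower, inr_not_mem_upper]

/-- The block of a vertex. -/
def block (a : PartitionMonoid X) (v : X ⊕ X) : Set (X ⊕ X) := {w | a.toSetoid w v}

theorem block_mem (a : PartitionMonoid X) (v : X ⊕ X) : a.block v ∈ a.blocks := ⟨v, rfl⟩

theorem eq_block_of_mem {a : PartitionMonoid X} {s : Set (X ⊕ X)} (hs : s ∈ a.blocks) {v : X ⊕ X}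
    (hv : v ∈ s) : s = a.block v := by
  obtain ⟨w, rfl⟩ := hs
  ext z
  exact ⟨fun h => a.toSetoid.trans h (a.toSetoid.symm hv), fun h => a.toSetoid.trans h hv⟩

theorem trace_eq_self_iff {s : Set (X ⊕ X)} {A : Set X} :
    trace s A = s ↔ s ⊆ upper A ∪ lower A := Set.inter_eq_left

theorem isTransversalFree_iff {a : PartitionMonoid X} :
    a.IsTransversalFree ↔ ∀ x y, ¬ a.toSetoid (Sum.inl x) (Sum.inr y) := by
  constructor
  · intro h x y hxy
    exact h _ (a.block_mem (Sum.inr y)) ⟨⟨x, hxy⟩, ⟨y, a.toSetoid.refl _⟩⟩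
  · rintro h s hs ⟨⟨x, hx⟩, ⟨y, hy⟩⟩
    rw [eq_block_of_mem hs hy] at hx
    exact h x y hx

theorem isOneTransversal_iff {a : PartitionMonoid X} :
    a.IsOneTransversal ↔ ∃ x y, a.toSetoid (Sum.inl x) (Sum.inr y) ∧
      ∀ x' y', a.toSetoid (Sum.inl x') (Sum.inr y') → a.toSetoid (Sum.inl x') (Sum.inl x) := by
  constructor
  · rintro ⟨s, ⟨hs, ⟨x, hx⟩, ⟨y, hy⟩⟩, huniq⟩
    have hxy : a.toSetoid (Sum.inl x) (Sum.inr y) := by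
      rw [eq_block_of_mem hs hy] at hx
      exact hx
    refine ⟨x, y, hxy, fun x' y' h => ?_⟩
    have := huniq (a.block (Sum.inr y')) ⟨a.block_mem _, ⟨x', h⟩, ⟨y', a.toSetoid.refl _⟩⟩
    have hx' : Sum.inl x' ∈ a.block (Sum.inr y') := h
    rw [this, eq_block_of_mem hs hx] at hx'
    exact hx'
  · rintro ⟨x, y, hxy, h⟩
    refine ⟨a.block (Sum.inr y), ⟨a.block_mem _, ⟨x, hxy⟩, ⟨y, a.toSetoid.refl _⟩⟩, ?_⟩
    rintro t ⟨ht, ⟨x', hx'⟩, ⟨y', hy'⟩⟩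
    rw [eq_block_of_mem ht hy'] at hx' ⊢
    have h1 : a.toSetoid (Sum.inr y') (Sum.inr y) := a.toSetoid.trans (a.toSetoid.symm hx')
      (a.toSetoid.trans (h x' y' hx') hxy)
    exact (eq_block_of_mem (a.block_mem _) h1).symm

/-- Normal form means that no connected set of at least two points is collapsible. -/
theorem isNormalForm_iff {b : PartitionMonoid X} :
    b.IsNormalForm ↔ ∀ A : Set X, A.Nontrivial → (b.subpartition A).IsConnected →
      ¬ b.IsCollapsible A := by
  constructor
  · rintro ⟨h1, h2⟩ A hA hc ⟨u, hu, l, hl, hU, hL⟩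
    by_cases hf : (b.subpartition A).IsTransversalFree
    · obtain ⟨s, hs, t, ht, ⟨v, hv⟩, ⟨w, hw⟩, hne, hss, htt, ⟨hsu, htu⟩ | ⟨hsl, htl⟩⟩ :=
        h1 A hA hc hf
      · obtain ⟨x, hx, rfl⟩ := hsu hv
        obtain ⟨y, hy, rfl⟩ := htu hw
        obtain rfl := eq_block_of_mem hs hv.1
        obtain rfl := eq_block_of_mem ht hw.1
        have hx' : b.toSetoid (Sum.inl x) (Sum.inl u) := by
          by_contra hn
          exact hss (trace_eq_self_iff.2 fun z hz => Or.inl (hU x hx hn z (b.toSetoid.symm hz)))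
        have hy' : b.toSetoid (Sum.inl y) (Sum.inl u) := by
          by_contra hn
          exact htt (trace_eq_self_iff.2 fun z hz => Or.inl (hU y hy hn z (b.toSetoid.symm hz)))
        exact hne (by rw [eq_block_of_mem (b.block_mem (Sum.inl y))
          (b.toSetoid.trans hx' (b.toSetoid.symm hy'))])
      · obtain ⟨x, hx, rfl⟩ := hsl hv
        obtain ⟨y, hy, rfl⟩ := htl hw
        obtain rfl := eq_block_of_mem hs hv.1
        obtain rfl := eq_block_of_mem ht hw.1
        have hx' : b.toSetoid (Sum.inr x) (Sum.inr l) := by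
          by_contra hn
          exact hss (trace_eq_self_iff.2 fun z hz => Or.inr (hL x hx hn z (b.toSetoid.symm hz)))
        have hy' : b.toSetoid (Sum.inr y) (Sum.inr l) := by
          by_contra hn
          exact htt (trace_eq_self_iff.2 fun z hz => Or.inr (hL y hy hn z (b.toSetoid.symm hz)))
        exact hne (by rw [eq_block_of_mem (b.block_mem (Sum.inr y))
          (b.toSetoid.trans hx' (b.toSetoid.symm hy'))])
    · have hul : ∀ x ∈ A, ∀ y ∈ A, b.toSetoid (Sum.inl x) (Sum.inr y) →
          b.toSetoid (Sum.inl x) (Sum.inl u) ∧ b.toSetoid (Sum.inr y) (Sum.inr l) := by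
        intro x hx y hy hxy
        constructor
        · by_contra hn
          exact inr_not_mem_upper (hU x hx hn _ hxy)
        · by_contra hn
          exact inl_not_mem_lower (hL y hy hn _ (b.toSetoid.symm hxy))
      rw [isTransversalFree_iff] at hf
      push Not at hf
      obtain ⟨⟨x, hx⟩, ⟨y, hy⟩, hxy⟩ := hf
      have hxy' : b.toSetoid (Sum.inl x) (Sum.inr y) := hxy
      obtain ⟨hxu, hyl⟩ := hul x hx y hy hxy'
      have hone : (b.subpartition A).IsOneTransversal := isOneTransversal_iff.2
        ⟨⟨x, hx⟩, ⟨y, hy⟩, hxy, fun ⟨x', hx'⟩ ⟨y', hy'⟩ h =>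
          b.toSetoid.trans (hul x' hx' y' hy' h).1 (b.toSetoid.symm hxu)⟩
      obtain ⟨t, ht, ⟨w, hw⟩, hne, htt⟩ := h2 A hA hc hone (b.block (Sum.inr y)) (b.block_mem _)
        ⟨⟨x, mem_trace_inl.2 ⟨hxy, hx⟩⟩, ⟨y, mem_trace_inr.2 ⟨b.toSetoid.refl _, hy⟩⟩⟩
      obtain rfl := eq_block_of_mem ht hw.1
      have hwy : ¬ b.toSetoid w (Sum.inr y) := fun h => hne (by
        rw [eq_block_of_mem (b.block_mem (Sum.inr y)) (v := w) h])
      rcases w with w | w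
      · have hw' := (mem_trace_inl.1 hw).2
        exact htt (trace_eq_self_iff.2 fun z hz => Or.inl (hU w hw'
          (fun h => hwy (b.toSetoid.trans h (b.toSetoid.trans (b.toSetoid.symm hxu) hxy')))
          z (b.toSetoid.symm hz))).symm
      · have hw' := (mem_trace_inr.1 hw).2
        exact htt (trace_eq_self_iff.2 fun z hz => Or.inr (hL w hw'
          (fun h => hwy (b.toSetoid.trans h (b.toSetoid.symm hyl)))
          z (b.toSetoid.symm hz))).symm
  · intro H
    constructor
    · intro A hA hc hf
      by_contra hn
      refine H A hA hc ?_
      rw [isTransversalFree_iff] at hf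
      have hf' : ∀ x ∈ A, ∀ y ∈ A, ¬ b.toSetoid (Sum.inl x) (Sum.inr y) :=
        fun x hx y hy => hf ⟨x, hx⟩ ⟨y, hy⟩
      obtain ⟨p, hp⟩ := hA.nonempty
      have hu : ∃ u ∈ A, ∀ x ∈ A, ¬ b.toSetoid (Sum.inl x) (Sum.inl u) →
          ∀ v, b.toSetoid (Sum.inl x) v → v ∈ upper A := by
        -- Any vertex whose block leaves the row serves as `u`; a second such block would give the
        -- pair required by normal form.
        by_cases hbad : ∃ u ∈ A, ∃ v, b.toSetoid (Sum.inl u) v ∧ v ∉ upper A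
        · obtain ⟨u, hu, v, huv, hv⟩ := hbad
          refine ⟨u, hu, fun x hx hxu w hw => ?_⟩
          by_contra hwA
          have hout : ∀ x ∈ A, ∀ v, b.toSetoid (Sum.inl x) v → v ∉ upper A →
              trace (b.block (Sum.inl x)) A ≠ b.block (Sum.inl x) := by
            intro x hx v hv hvA he
            rcases trace_eq_self_iff.1 he (b.toSetoid.symm hv) with h | ⟨y, hy, rfl⟩
            · exact hvA h
            · exact hf' x hx y hy hv
          have hsub : ∀ x ∈ A, trace (b.block (Sum.inl x)) A ⊆ upper A := by
            rintro x hx v ⟨hv, h | ⟨y, hy, rfl⟩⟩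
            · exact h
            · exact (hf' x hx y hy (b.toSetoid.symm hv)).elim
          refine hn ⟨_, b.block_mem (Sum.inl u), _, b.block_mem (Sum.inl x),
            ⟨_, mem_trace_inl.2 ⟨b.toSetoid.refl _, hu⟩⟩,
            ⟨_, mem_trace_inl.2 ⟨b.toSetoid.refl _, hx⟩⟩, fun he => hxu ?_,
            hout u hu v huv hv, hout x hx w hw hwA, Or.inl ⟨hsub u hu, hsub x hx⟩⟩
          have hx' := mem_trace_inl.2 ⟨b.toSetoid.refl (Sum.inl x), hx⟩
          change _ ∈ trace (b.block (Sum.inl x)) A at hx'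
          rw [← he] at hx'
          exact hx'.1
        · push Not at hbad
          exact ⟨p, hp, fun x hx _ v hv => hbad x hx v hv⟩
      have hl : ∃ l ∈ A, ∀ x ∈ A, ¬ b.toSetoid (Sum.inr x) (Sum.inr l) →
          ∀ v, b.toSetoid (Sum.inr x) v → v ∈ lower A := by
        by_cases hbad : ∃ u ∈ A, ∃ v, b.toSetoid (Sum.inr u) v ∧ v ∉ lower A
        · obtain ⟨u, hu, v, huv, hv⟩ := hbad
          refine ⟨u, hu, fun x hx hxu w hw => ?_⟩
          by_contra hwA
          have hout : ∀ x ∈ A, ∀ v, b.toSetoid (Sum.inr x) v → v ∉ lower A →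
              trace (b.block (Sum.inr x)) A ≠ b.block (Sum.inr x) := by
            intro x hx v hv hvA he
            rcases trace_eq_self_iff.1 he (b.toSetoid.symm hv) with ⟨y, hy, rfl⟩ | h
            · exact hf' y hy x hx (b.toSetoid.symm hv)
            · exact hvA h
          have hsub : ∀ x ∈ A, trace (b.block (Sum.inr x)) A ⊆ lower A := by
            rintro x hx v ⟨hv, ⟨y, hy, rfl⟩ | h⟩
            · exact (hf' y hy x hx hv).elim
            · exact h
          refine hn ⟨_, b.block_mem (Sum.inr u), _, b.block_mem (Sum.inr x),
            ⟨_, mem_trace_inr.2 ⟨b.toSetoid.refl _, hu⟩⟩,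
            ⟨_, mem_trace_inr.2 ⟨b.toSetoid.refl _, hx⟩⟩, fun he => hxu ?_,
            hout u hu v huv hv, hout x hx w hw hwA, Or.inr ⟨hsub u hu, hsub x hx⟩⟩
          have hx' := mem_trace_inr.2 ⟨b.toSetoid.refl (Sum.inr x), hx⟩
          change _ ∈ trace (b.block (Sum.inr x)) A at hx'
          rw [← he] at hx'
          exact hx'.1
        · push Not at hbad
          exact ⟨p, hp, fun x hx _ v hv => hbad x hx v hv⟩
      obtain ⟨u, hu, hU⟩ := hu
      obtain ⟨l, hl, hL⟩ := hl
      exact ⟨u, hu, l, hl, hU, hL⟩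
    · rintro A hA hc ho s hs ⟨⟨u, hus⟩, ⟨l, hls⟩⟩
      by_contra hn
      push Not at hn
      refine H A hA hc ?_
      rw [mem_trace_inl] at hus
      rw [mem_trace_inr] at hls
      obtain ⟨hus, hu⟩ := hus
      obtain ⟨hls, hl⟩ := hls
      have hul : b.toSetoid (Sum.inl u) (Sum.inr l) := by
        rw [eq_block_of_mem hs hls] at hus
        exact hus
      obtain ⟨⟨x₀, hx₀⟩, ⟨y₀, hy₀⟩, h₀, ho⟩ := isOneTransversal_iff.1 ho
      have ho' : ∀ x ∈ A, ∀ y ∈ A, b.toSetoid (Sum.inl x) (Sum.inr y) →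
          b.toSetoid (Sum.inl x) (Sum.inl u) := fun x hx y hy hxy =>
        b.toSetoid.trans (ho ⟨x, hx⟩ ⟨y, hy⟩ hxy) (b.toSetoid.symm (ho ⟨u, hu⟩ ⟨l, hl⟩ hul))
      refine ⟨u, hu, l, hl, fun x hx hxu v hv => ?_, fun x hx hxl v hv => ?_⟩
      · have h1 := hn (b.block (Sum.inl x)) (b.block_mem _)
          ⟨_, mem_trace_inl.2 ⟨b.toSetoid.refl _, hx⟩⟩ (fun he => hxu ?_)
        · rcases trace_eq_self_iff.1 h1.symm (b.toSetoid.symm hv) with h | ⟨y, hy, rfl⟩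
          · exact h
          · exact (hxu (ho' x hx y hy hv)).elim
        · have := mem_trace_inl.2 ⟨hus, hu⟩
          rw [← he] at this
          exact b.toSetoid.symm this.1
      · have h1 := hn (b.block (Sum.inr x)) (b.block_mem _)
          ⟨_, mem_trace_inr.2 ⟨b.toSetoid.refl _, hx⟩⟩ (fun he => hxl ?_)
        · rcases trace_eq_self_iff.1 h1.symm (b.toSetoid.symm hv) with ⟨y, hy, rfl⟩ | h
          · refine (hxl ?_).elim
            exact b.toSetoid.trans hv (b.toSetoid.trans
              (ho' y hy x hx (b.toSetoid.symm hv)) hul)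
          · exact h
        · have := mem_trace_inr.2 ⟨hls, hl⟩
          rw [← he] at this
          exact b.toSetoid.symm this.1

/-! ### Collapsing a set to a point -/

open scoped Classical in
/-- The labelling whose fibres are the blocks of `collapse a A u p`. Labels in the first summand
are points of `X`, those in the second keep the vertices `x'` with `x ∈ A \ {p}` isolated, and
those in the third are blocks of `a`. -/
noncomputable def collapseLabel (a : PartitionMonoid X) (A : Set X) (u p : X) :
    X ⊕ X → X ⊕ (X ⊕ Quotient a.toSetoid) :=
  Sum.elim
    (fun x => if x ∈ A then
        if a.toSetoid (Sum.inl x) (Sum.inl u) then Sum.inl p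
        else Sum.inr (Sum.inr (Quotient.mk _ (Sum.inl x)))
      else Sum.inl x)
    (fun x => if x ∈ A ∧ x ≠ p then Sum.inr (Sum.inl x) else Sum.inl x)

/-- The partition which is the identity off `A`, joins the trace of the block of `u` on the upper
row of `A` to `p'`, and has the traces of the other blocks of `a` on the upper row of `A` and the
points `x'` with `x ∈ A \ {p}` as blocks. Here `u` and `p` are meant to be elements of `A`. -/
noncomputable def collapse (a : PartitionMonoid X) (A : Set X) (u p : X) : PartitionMonoid X :=
  ⟨Setoid.ker (collapseLabel a A u p)⟩

theorem collapse_rel {a : PartitionMonoid X} {A : Set X} {u p : X} {v w : X ⊕ X} :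
    (collapse a A u p).toSetoid v w ↔ collapseLabel a A u p v = collapseLabel a A u p w := Iff.rfl

section

variable {a : PartitionMonoid X} {A : Set X} {u p : X}

theorem collapseLabel_inl_of_notMem {x : X} (hx : x ∉ A) :
    collapseLabel a A u p (Sum.inl x) = Sum.inl x := by
  simp [collapseLabel, hx]

theorem collapseLabel_inl_of_rel {x : X} (hx : x ∈ A) (h : a.toSetoid (Sum.inl x) (Sum.inl u)) :
    collapseLabel a A u p (Sum.inl x) = Sum.inl p := by
  simp [collapseLabel, hx, h]

theorem collapseLabel_inl_of_not_rel {x : X} (hx : x ∈ A)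
    (h : ¬ a.toSetoid (Sum.inl x) (Sum.inl u)) :
    collapseLabel a A u p (Sum.inl x) = Sum.inr (Sum.inr (Quotient.mk _ (Sum.inl x))) := by
  simp [collapseLabel, hx, h]

theorem collapseLabel_inr_of_notMem {x : X} (hx : x ∉ A) :
    collapseLabel a A u p (Sum.inr x) = Sum.inl x := by
  simp [collapseLabel, hx]

theorem collapseLabel_inr_self : collapseLabel a A u p (Sum.inr p) = Sum.inl p := by
  simp [collapseLabel]

theorem collapseLabel_inr_of_ne {x : X} (hx : x ∈ A) (h : x ≠ p) :
    collapseLabel a A u p (Sum.inr x) = Sum.inr (Sum.inl x) := by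
  simp [collapseLabel, hx, h]

/-- On the upper row of `A`, the collapsing partition contains the kernel of `a`. -/
theorem collapse_inl_inl {x y : X} (hx : x ∈ A) (hy : y ∈ A)
    (h : a.toSetoid (Sum.inl x) (Sum.inl y)) :
    (collapse a A u p).toSetoid (Sum.inl x) (Sum.inl y) := by
  rw [collapse_rel]
  by_cases hu : a.toSetoid (Sum.inl y) (Sum.inl u)
  · rw [collapseLabel_inl_of_rel hx (a.toSetoid.trans h hu), collapseLabel_inl_of_rel hy hu]
  · rw [collapseLabel_inl_of_not_rel hx fun h' => hu (a.toSetoid.trans (a.toSetoid.symm h) h'),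
      collapseLabel_inl_of_not_rel hy hu, Quotient.sound h]

/-- A labelling of the two rows is constant on the blocks of `collapse a A u p` as soon as it is
constant on the required pieces. -/
theorem label_eq_of_collapse (hp : p ∈ A) {T : Type*} {t m : X → T}
    (hid : ∀ x ∉ A, t x = m x) (hu : ∀ x ∈ A, a.toSetoid (Sum.inl x) (Sum.inl u) → t x = m p)
    (ht : ∀ x ∈ A, ∀ y ∈ A, a.toSetoid (Sum.inl x) (Sum.inl y) → t x = t y)
    (v w : X ⊕ X) (h : (collapse a A u p).toSetoid v w) : Sum.elim t m v = Sum.elim t m w := by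
  rw [collapse_rel] at h
  -- The label of a vertex determines its value under `Sum.elim t m`.
  have key : ∀ v : X ⊕ X,
      (∃ x, collapseLabel a A u p v = Sum.inl x ∧ Sum.elim t m v = m x) ∨
      (∃ x, collapseLabel a A u p v = Sum.inr (Sum.inl x) ∧ Sum.elim t m v = m x) ∨
      (∃ x ∈ A, collapseLabel a A u p v = Sum.inr (Sum.inr (Quotient.mk _ (Sum.inl x))) ∧
        Sum.elim t m v = t x) := by
    rintro (x | x)
    · by_cases hx : x ∈ A
      · by_cases hxu : a.toSetoid (Sum.inl x) (Sum.inl u)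
        · exact Or.inl ⟨p, collapseLabel_inl_of_rel hx hxu, hu x hx hxu⟩
        · exact Or.inr (Or.inr ⟨x, hx, collapseLabel_inl_of_not_rel hx hxu, rfl⟩)
      · exact Or.inl ⟨x, collapseLabel_inl_of_notMem hx, hid x hx⟩
    · by_cases hx : x ∈ A
      · by_cases hxp : x = p
        · subst hxp
          exact Or.inl ⟨x, collapseLabel_inr_self, rfl⟩
        · exact Or.inr (Or.inl ⟨x, collapseLabel_inr_of_ne hx hxp, rfl⟩)
      · exact Or.inl ⟨x, collapseLabel_inr_of_notMem hx, rfl⟩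
  rcases key v with ⟨x, hx, hx'⟩ | ⟨x, hx, hx'⟩ | ⟨x, hxA, hx, hx'⟩ <;>
  rcases key w with ⟨y, hy, hy'⟩ | ⟨y, hy, hy'⟩ | ⟨y, hyA, hy, hy'⟩ <;>
  rw [hx, hy] at h <;> simp only [Sum.inl.injEq, Sum.inr.injEq, reduceCtorEq] at h <;>
  rw [hx', hy']
  · rw [h]
  · rw [h]
  · exact ht x hxA y hyA (Quotient.exact h)

end

/-- The partition `g * h` obtained by collapsing `A` to `p` and expanding it again is a left
identity for `a`. -/
theorem collapse_mul_flip_collapse_mul {a : PartitionMonoid X} {A : Set X} {u l p : X}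
    (hl : l ∈ A) (hp : p ∈ A)
    (hU : ∀ x ∈ A, ¬ a.toSetoid (Sum.inl x) (Sum.inl u) →
      ∀ v, a.toSetoid (Sum.inl x) v → v ∈ upper A)
    (hc : (a.subpartition A).IsConnected) :
    collapse a A u p * (collapse a.flip A l p).flip * a = a := by
  classical
  set g := collapse a A u p with hg
  set h := (collapse a.flip A l p).flip with hh
  refine PartitionMonoid.ext (le_antisymm ?_ ?_)
  · intro v w hvw
    -- Inside `A`, every vertex of the two middle rows is joined to the block of `u`.
    set m : X → Quotient a.toSetoid := fun y =>
      if y ∈ A then Quotient.mk _ (Sum.inl u) else Quotient.mk _ (Sum.inl y) with hm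
    have hmA : ∀ y ∈ A, m y = Quotient.mk _ (Sum.inl u) := fun y hy => by simp [hm, hy]
    have hmA' : ∀ y ∉ A, m y = Quotient.mk _ (Sum.inl y) := fun y hy => by simp [hm, hy]
    have h1 : ∀ v w, g.toSetoid v w →
        Sum.elim (fun x => (Quotient.mk _ (Sum.inl x) : Quotient a.toSetoid)) m v =
        Sum.elim (fun x => (Quotient.mk _ (Sum.inl x) : Quotient a.toSetoid)) m w := by
      refine label_eq_of_collapse hp (fun x hx => (hmA' x hx).symm) (fun x hx hxu => ?_)
        (fun x _ y _ hxy => Quotient.sound hxy)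
      rw [hmA p hp]
      exact Quotient.sound hxu
    have h2 : ∀ v w, h.toSetoid v w → Sum.elim m m v = Sum.elim m m w := by
      intro v w hvw
      have := label_eq_of_collapse (t := m) (m := m) hp (fun x _ => rfl)
        (fun x hx _ => by rw [hmA x hx, hmA p hp])
        (fun x hx y hy _ => by rw [hmA x hx, hmA y hy]) _ _ (flip_rel.1 hvw)
      rcases v with v | v <;> rcases w with w | w <;> exact this
    have h3 : ∀ v w, a.toSetoid v w →
        Sum.elim m (fun x => (Quotient.mk _ (Sum.inr x) : Quotient a.toSetoid)) v =
        Sum.elim m (fun x => (Quotient.mk _ (Sum.inr x) : Quotient a.toSetoid)) w := by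
      have aux : ∀ x w, a.toSetoid (Sum.inl x) w → m x =
          Sum.elim m (fun x => (Quotient.mk _ (Sum.inr x) : Quotient a.toSetoid)) w := by
        intro x w hxw
        -- Where `m` does not give the block of `x`, that block stays in the upper row of `A`.
        have half : ∀ x, m x = Quotient.mk _ (Sum.inl x) ∨
            (∀ v, a.toSetoid (Sum.inl x) v → v ∈ upper A) := by
          intro x
          by_cases hx : x ∈ A
          · by_cases hxu : a.toSetoid (Sum.inl x) (Sum.inl u)
            · rw [hmA x hx]
              exact Or.inl (Quotient.sound (a.toSetoid.symm hxu))
            · exact Or.inr (hU x hx hxu)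
          · exact Or.inl (hmA' x hx)
        rcases half x with hx | hx
        · rcases w with y | y
          · rcases half y with hy | hy
            · exact hx.trans ((Quotient.sound hxw).trans hy.symm)
            · have hxA := inl_mem_upper.1 (hy _ (a.toSetoid.symm hxw))
              have hyA := inl_mem_upper.1 (hy _ (a.toSetoid.refl _))
              exact (hmA x hxA).trans (hmA y hyA).symm
          · exact hx.trans (Quotient.sound hxw)
        · obtain ⟨y, hy, rfl⟩ := hx w hxw
          have hxA := inl_mem_upper.1 (hx _ (a.toSetoid.refl _))
          exact (hmA x hxA).trans (hmA y hy).symm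
      rintro (x | x) w hxw
      · exact aux x w hxw
      · rcases w with y | y
        · exact (aux y _ (a.toSetoid.symm hxw)).symm
        · exact Quotient.sound hxw
    have := label_eq_of_mul _ _ _ (label_eq_of_mul _ _ _ h1 h2) h3 v w hvw
    rcases v with v | v <;> rcases w with w | w <;> exact Quotient.exact this
  · set S := stack (g * h) a with hS
    have hup : ∀ x ∈ A, ∀ y ∈ A, a.toSetoid (Sum.inl x) (Sum.inl y) →
        S (Sum.inl x) (Sum.inl y) := fun x hx y hy hxy =>
      stack_topMid (a := g * h) (u := Sum.inl x) (v := Sum.inl y) a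
        (ker_le_ker_mul g h (collapse_inl_inl hx hy hxy))
    have hmid : ∀ x ∈ A, ∀ y ∈ A, S (Sum.inr (Sum.inl x)) (Sum.inr (Sum.inl y)) := by
      intro x hx y hy
      have : (a.subpartition A).ker ⊔ (a.subpartition A).coker ≤
          S.comap (fun z : A => Sum.inr (Sum.inl (z : X))) := by
        refine sup_le ?_ ?_
        · intro z w hzw
          exact stack_midBot (g * h) (b := a) (u := Sum.inl z.1) (v := Sum.inl w.1) hzw
        · intro z w hzw
          exact stack_topMid (a := g * h) (u := Sum.inr z.1) (v := Sum.inr w.1) a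
            (coker_le_coker_mul g h
              (collapse_inl_inl (a := a.flip) z.2 w.2 hzw))
      rw [show (a.subpartition A).ker ⊔ (a.subpartition A).coker = ⊤ from hc] at this
      exact this (x := ⟨x, hx⟩) (y := ⟨y, hy⟩) trivial
    -- Every vertex outside the blocks copied by `g` is joined to the corresponding vertex of `a`.
    have hdown : ∀ v, (∃ x ∈ A, v = Sum.inl x ∧ ¬ a.toSetoid (Sum.inl x) (Sum.inl u)) ∨
        S (topBot v) (midBot v) := by
      rintro (x | x)
      · by_cases hx : x ∈ A
        · by_cases hxu : a.toSetoid (Sum.inl x) (Sum.inl u)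
          · right
            have h1 : (g * h).toSetoid (Sum.inl x) (Sum.inr l) :=
              mul_inl_inr_iff.2 ⟨p, p, collapse_rel.2 (by
                  rw [collapseLabel_inl_of_rel hx hxu, collapseLabel_inr_self]),
                (g.coker ⊔ h.ker).refl _, flip_rel.2 (collapse_rel.2 (by
                  simp only [Sum.swap_inl, Sum.swap_inr]
                  rw [collapseLabel_inl_of_rel hl (a.flip.toSetoid.refl _),
                    collapseLabel_inr_self]))⟩
            exact S.trans (stack_topMid a h1) (hmid l hl x hx)
          · exact Or.inl ⟨x, hx, rfl, hxu⟩
        · right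
          have h1 : (g * h).toSetoid (Sum.inl x) (Sum.inr x) :=
            mul_inl_inr_iff.2 ⟨x, x, collapse_rel.2 (by
                rw [collapseLabel_inl_of_notMem hx, collapseLabel_inr_of_notMem hx]),
              (g.coker ⊔ h.ker).refl _, flip_rel.2 (collapse_rel.2 (by
                simp only [Sum.swap_inl, Sum.swap_inr]
                rw [collapseLabel_inl_of_notMem hx, collapseLabel_inr_of_notMem hx]))⟩
          exact stack_topMid a h1
      · exact Or.inr (S.refl _)
    intro v w hvw
    change S (topBot v) (topBot w)
    rcases hdown v with ⟨x, hx, rfl, hxu⟩ | hv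
    · obtain ⟨y, hy, rfl⟩ := hU x hx hxu w hvw
      exact hup x hx y hy hvw
    · rcases hdown w with ⟨x, hx, rfl, hxu⟩ | hw
      · obtain ⟨y, hy, rfl⟩ := hU x hx hxu v (a.toSetoid.symm hvw)
        exact hup y hy x hx hvw
      · exact S.trans hv (S.trans (stack_midBot _ hvw) (S.symm hw))

theorem isConnected_flip_subpartition {a : PartitionMonoid X} {A : Set X}
    (h : (a.subpartition A).IsConnected) : (a.flip.subpartition A).IsConnected := by
  change (a.flip.subpartition A).ker ⊔ (a.flip.subpartition A).coker = ⊤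
  rw [sup_comm]
  exact h

/-- The mirror image under `flip` of `collapse_mul_flip_collapse_mul`. -/
theorem mul_collapse_mul_flip_collapse {a : PartitionMonoid X} {A : Set X} {u l p : X}
    (hu : u ∈ A) (hp : p ∈ A)
    (hL : ∀ x ∈ A, ¬ a.toSetoid (Sum.inr x) (Sum.inr l) →
      ∀ v, a.toSetoid (Sum.inr x) v → v ∈ lower A)
    (hc : (a.subpartition A).IsConnected) :
    a * (collapse a A u p * (collapse a.flip A l p).flip) = a := by
  have key := collapse_mul_flip_collapse_mul (a := a.flip) (u := l) (l := u) hu hp ?_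
    (isConnected_flip_subpartition hc)
  · have := congrArg flip key
    simpa using this
  · intro x hx hxl v hv
    have := hL x hx hxl v.swap hv
    rcases v with v | v
    · exact inl_mem_upper.2 (inr_mem_lower.1 this)
    · exact (inl_not_mem_lower this).elim

/-! ### Existence of normal forms -/

/-- The points `x` for which `{x}` and `{x'}` are not both blocks of `a`. -/
def support (a : PartitionMonoid X) : Set X :=
  {x | ¬ ((∀ v, a.toSetoid (Sum.inl x) v → v = Sum.inl x) ∧
    ∀ v, a.toSetoid (Sum.inr x) v → v = Sum.inr x)}

theorem support_flip (a : PartitionMonoid X) : a.flip.support = a.support := by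
  ext x
  change ¬ (_ ∧ _) ↔ ¬ (_ ∧ _)
  rw [and_comm, not_iff_not]
  refine and_congr ⟨fun h v hv => ?_, fun h v hv => ?_⟩ ⟨fun h v hv => ?_, fun h v hv => ?_⟩ <;>
  · have := h v.swap (by simpa [flip_rel] using hv)
    simpa using congrArg Sum.swap this

/-- A connected set with at least two points lies in the support. -/
theorem subset_support_of_isConnected {a : PartitionMonoid X} {A : Set X} (hA : A.Nontrivial)
    (hc : (a.subpartition A).IsConnected) : A ⊆ a.support := by
  rintro x hx ⟨h1, h2⟩
  obtain ⟨y, hy, hyx⟩ := hA.exists_ne x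
  -- The partition of `A` into `{x}` and its complement contains the kernel and the cokernel.
  have : (a.subpartition A).ker ⊔ (a.subpartition A).coker ≤
      Setoid.ker (fun z : A => (z : X) = x) := by
    refine sup_le ?_ ?_
    · intro z w hzw
      have hzw' : a.toSetoid (Sum.inl z.1) (Sum.inl w.1) := hzw
      refine propext ⟨fun e => ?_, fun e => ?_⟩
      · rw [e] at hzw'
        exact Sum.inl_injective (h1 _ hzw')
      · rw [e] at hzw'
        exact Sum.inl_injective (h1 _ (a.toSetoid.symm hzw'))
    · intro z w hzw
      have hzw' : a.toSetoid (Sum.inr z.1) (Sum.inr w.1) := hzw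
      refine propext ⟨fun e => ?_, fun e => ?_⟩
      · rw [e] at hzw'
        exact Sum.inr_injective (h2 _ hzw')
      · rw [e] at hzw'
        exact Sum.inr_injective (h2 _ (a.toSetoid.symm hzw'))
  rw [show (a.subpartition A).ker ⊔ (a.subpartition A).coker = ⊤ from hc] at this
  have h := this (x := ⟨x, hx⟩) (y := ⟨y, hy⟩) trivial
  exact hyx (h.mp rfl)

theorem collapse_inr_isolated {a : PartitionMonoid X} {A : Set X} {u p x : X} (hp : p ∈ A)
    (hx : x ∈ A) (hxp : x ≠ p) {v : X ⊕ X} (h : (collapse a A u p).toSetoid (Sum.inr x) v) :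
    v = Sum.inr x := by
  have := label_eq_of_collapse hp (t := fun _ => False) (m := fun y => y = x ∧ y ∈ A)
    (fun y hy => by simp [hy]) (fun y _ _ => by simp [hxp.symm]) (fun _ _ _ _ _ => rfl) _ _ h
  rcases v with v | v
  · simp [hx] at this
  · rw [(this.mp ⟨rfl, hx⟩).1]

/-- Collapsing `A` to `p` isolates the upper points of `A` other than `p`, and preserves isolated
upper points outside `A`. -/
theorem flip_collapse_mul_isolated {a c : PartitionMonoid X} {A : Set X} {l p x : X} (hp : p ∈ A)
    (hx : x ∈ A \ {p} ∨ x ∉ A ∧ ∀ v, a.toSetoid (Sum.inl x) v → v = Sum.inl x) (v : X ⊕ X)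
    (h : ((collapse c A l p).flip * a).toSetoid (Sum.inl x) v) : v = Sum.inl x := by
  rcases hx with ⟨hxA, hxp⟩ | ⟨hxA, hxa⟩
  · have iso : ∀ v, (collapse c A l p).flip.toSetoid (Sum.inl x) v → v = Sum.inl x := by
      intro v hv
      have := collapse_inr_isolated hp hxA hxp (flip_rel.1 hv)
      simpa using congrArg Sum.swap this
    exact iso v (mul_rel_of_forall_not (fun z hz => by simpa using iso _ hz) h)
  · have := label_eq_of_mul (fun y => y = x) (fun y => y = x) (fun _ => False) ?_ ?_ _ _ h
    · rcases v with v | v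
      · rw [this.mp rfl]
      · exact (this.mp rfl).elim
    · intro v w hvw
      have ne : ∀ y ∈ A, y ≠ x := fun y hy e => hxA (e ▸ hy)
      have := label_eq_of_collapse hp (t := fun y => y = x) (m := fun y => y = x) (fun y _ => rfl)
        (fun y hy _ => by simp [ne y hy, ne p hp])
        (fun y hy z hz _ => by simp [ne y hy, ne z hz]) _ _ (flip_rel.1 hvw)
      rcases v with v | v <;> rcases w with w | w <;> exact this
    · have aux : ∀ v w, a.toSetoid v w → Sum.elim (fun y => y = x) (fun _ => False) v →
          Sum.elim (fun y => y = x) (fun _ => False) w := by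
        rintro (v | v) w hvw hv
        · obtain rfl : v = x := hv
          rw [hxa w hvw]
          rfl
        · exact hv.elim
      exact fun v w hvw => propext ⟨aux v w hvw, aux w v (a.toSetoid.symm hvw)⟩

/-- Collapsing a connected set strictly shrinks the support. -/
theorem support_collapse_ssubset {a : PartitionMonoid X} {A : Set X} {u l p : X}
    (hA : A.Nontrivial) (hp : p ∈ A) (hc : (a.subpartition A).IsConnected) :
    ((collapse a.flip A l p).flip * a * collapse a A u p).support ⊂ a.support := by
  have hsub := subset_support_of_isConnected hA hc
  set b := (collapse a.flip A l p).flip * a * collapse a A u p with hb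
  have iso : ∀ x, x ∈ A \ {p} ∨ (x ∉ A ∧ x ∉ a.support) → x ∉ b.support := by
    intro x hx hxb
    refine hxb ⟨fun v hv => ?_, fun v hv => ?_⟩
    · rw [hb, mul_assoc] at hv
      refine flip_collapse_mul_isolated hp (hx.imp_right fun h => ⟨h.1, fun v hv => ?_⟩) v hv
      exact (not_not.1 h.2).1 v
        (mul_rel_of_forall_not (fun z hz => by simpa using (not_not.1 h.2).1 _ hz) hv)
    · have hv' : b.flip.toSetoid (Sum.inl x) v.swap := by simpa [flip_rel] using hv
      have e : b.flip = (collapse a A u p).flip * (a.flip * collapse a.flip A l p) := by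
        simp [hb]
      rw [e] at hv'
      have := flip_collapse_mul_isolated hp (hx.imp_right fun h => ⟨h.1, fun v hv => ?_⟩) _ hv'
      · simpa using congrArg Sum.swap this
      · have h2 := (not_not.1 (support_flip a ▸ h.2)).1
        exact h2 v (mul_rel_of_forall_not (fun z hz => by simpa using h2 _ hz) hv)
  refine ⟨fun x hx => ?_, fun hle => ?_⟩
  · by_contra hxa
    exact iso x (Or.inr ⟨fun h => hxa (hsub h), hxa⟩) hx
  · obtain ⟨y, hy, hyp⟩ := hA.exists_ne p
    exact iso y (Or.inl ⟨hy, hyp⟩) (hle (hsub hy))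

theorem exists_naturallyConj_isNormalForm [Finite X] (a : PartitionMonoid X) :
    ∃ b, NaturallyConj b a ∧ b.IsNormalForm := by
  induction hn : a.support.ncard using Nat.strong_induction_on generalizing a with
  | _ n ih =>
    by_cases ha : a.IsNormalForm
    · refine ⟨a, ?_, ha⟩
      simpa using naturallyConj_of_mul_eq (a := a) (g := 1) (h := 1) (by simp) (by simp)
    · rw [isNormalForm_iff] at ha
      push Not at ha
      obtain ⟨A, hA, hc, u, hu, l, hl, hU, hL⟩ := ha
      have hlt := Set.ncard_lt_ncard (support_collapse_ssubset (u := u) (l := l) hA hu hc)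
        (Set.toFinite _)
      obtain ⟨b, hb, hbn⟩ := ih _ (hn ▸ hlt) _ rfl
      exact ⟨b, hb.trans (naturallyConj_of_mul_eq
        (collapse_mul_flip_collapse_mul hl hu hU hc)
        (mul_collapse_mul_flip_collapse hu hu hL hc)).symm, hbn⟩

/-! ### Conjugacy of normal forms -/

/-- A class of a join of two equivalence relations is connected for their restrictions. -/
theorem comap_sup_comap_class_eq_top (r s : Setoid X) (x : X) :
    r.comap (Subtype.val : {y | (r ⊔ s) x y} → X) ⊔
      s.comap (Subtype.val : {y | (r ⊔ s) x y} → X) = ⊤ := by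
  classical
  set C : Set X := {y | (r ⊔ s) x y} with hC
  set K := r.comap (Subtype.val : C → X) ⊔ s.comap (Subtype.val : C → X) with hK
  let F : X → Option (Quotient K) := fun y =>
    if h : y ∈ C then some (Quotient.mk _ ⟨y, h⟩) else none
  have aux : ∀ t : Setoid X, t ≤ r ⊔ s → t.comap (Subtype.val : C → X) ≤ K →
      t ≤ Setoid.ker F := by
    intro t ht htK y z hyz
    change F y = F z
    by_cases hy : y ∈ C
    · have hz : z ∈ C := (r ⊔ s).trans hy (ht hyz)
      simp only [F, hy, hz, dif_pos]
      exact congrArg some (Quotient.sound (htK (x := ⟨y, hy⟩) (y := ⟨z, hz⟩) hyz))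
    · have hz : z ∉ C := fun hz => hy ((r ⊔ s).trans hz ((r ⊔ s).symm (ht hyz)))
      simp [F, hy, hz]
  have key : r ⊔ s ≤ Setoid.ker F := sup_le (aux r le_sup_left le_sup_left)
    (aux s le_sup_right le_sup_right)
  refine eq_top_iff.2 ?_
  rintro ⟨y, hy⟩ ⟨z, hz⟩ -
  have h : F y = F z := key ((r ⊔ s).trans ((r ⊔ s).symm hy) hz)
  simp only [F, hy, hz, dif_pos] at h
  exact Quotient.exact (Option.some_injective _ h)

/-- Turns right identities of `a` into left identities of `a.flip`. -/
theorem flip_mul_flip_eq {a e : PartitionMonoid X} (hae : a * e = a) :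
    e.flip * a.flip = a.flip := by
  rw [← flip_mul, hae]

/-- An idempotent acting as a two-sided identity on a normal form is a partial identity: each class
of the join of its kernel and cokernel is connected and collapsible for `a`. -/
theorem eq_of_ker_sup_coker {a e : PartitionMonoid X} (ha : a.IsNormalForm)
    (he : IsIdempotentElem e) (hea : e * a = a) (hae : a * e = a) {x y : X}
    (hxy : (e.ker ⊔ e.coker) x y) : x = y := by
  set R := e.ker ⊔ e.coker with hR
  by_contra hne
  have hk : ∀ {x y}, e.toSetoid (Sum.inl x) (Sum.inl y) → R x y := fun h =>
    (le_sup_left : e.ker ≤ R) h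
  have hck : ∀ {x y}, e.toSetoid (Sum.inr x) (Sum.inr y) → R x y := fun h =>
    (le_sup_right : e.coker ≤ R) h
  have hker : e.ker ≤ a.ker := hea ▸ ker_le_ker_mul e a
  have hcoker : e.coker ≤ a.coker := hae ▸ coker_le_coker_mul a e
  -- The two ends of a transversal of `e` lie in the same class.
  have htr : ∀ {z w}, e.toSetoid (Sum.inl z) (Sum.inr w) → R z w := by
    intro z w h
    have h' := h
    rw [← he.eq] at h'
    obtain ⟨z', w', h1, h2, h3⟩ := mul_inl_inr_iff.1 h'
    rw [sup_comm] at h2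
    have hw : R w z' := hck (e.toSetoid.trans (e.toSetoid.symm h) h1)
    have hz : R w' z := hk (e.toSetoid.trans h3 (e.toSetoid.symm h))
    exact R.symm (R.trans hw (R.trans h2 hz))
  -- Each class meets at most one transversal of `e`.
  have hone : ∀ {z w z' w'}, e.toSetoid (Sum.inl z) (Sum.inr w) →
      e.toSetoid (Sum.inl z') (Sum.inr w') → R z z' →
      e.toSetoid (Sum.inl z) (Sum.inl z') := by
    intro z w z' w' h h' hzz
    have : e.toSetoid (Sum.inl z) (Sum.inr w') := by
      rw [← he.eq]
      refine mul_inl_inr_iff.2 ⟨w, z', h, ?_, h'⟩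
      rw [sup_comm]
      exact R.trans (R.symm (htr h)) hzz
    exact e.toSetoid.trans this (e.toSetoid.symm h')
  set C : Set X := {z | R x z} with hC
  refine isNormalForm_iff.1 ha C ⟨x, R.refl x, y, hxy, hne⟩ ?_ ?_
  · refine eq_top_iff.2 ((comap_sup_comap_class_eq_top e.ker e.coker x).ge.trans ?_)
    exact sup_le_sup (fun _ _ h => hker h) (fun _ _ h => hcoker h)
  · have hup : ∀ z ∈ C, (∀ w, ¬ e.toSetoid (Sum.inl z) (Sum.inr w)) →
        ∀ v, a.toSetoid (Sum.inl z) v → v ∈ upper C := by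
      intro z hz hn v hv
      rw [← hea] at hv
      have := mul_rel_of_forall_not hn hv
      rcases v with v | v
      · exact inl_mem_upper.2 (R.trans hz (hk this))
      · exact (hn _ this).elim
    have hlow : ∀ z ∈ C, (∀ w, ¬ e.toSetoid (Sum.inl w) (Sum.inr z)) →
        ∀ v, a.toSetoid (Sum.inr z) v → v ∈ lower C := by
      intro z hz hn v hv
      have hv' : (e.flip * a.flip).toSetoid (Sum.inl z) v.swap := by
        rw [flip_mul_flip_eq hae]
        simpa [flip_rel] using hv
      have := mul_rel_of_forall_not (fun w hw => hn w (e.toSetoid.symm hw)) hv'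
      rcases v with v | v
      · exact (hn _ (e.toSetoid.symm this)).elim
      · exact inr_mem_lower.2 (R.trans hz (hck this))
    by_cases ht : ∃ u ∈ C, ∃ l, e.toSetoid (Sum.inl u) (Sum.inr l)
    · obtain ⟨u, hu, l, hul⟩ := ht
      refine ⟨u, hu, l, R.trans hu (htr hul), fun z hz hzu => hup z hz fun w hw => hzu ?_,
        fun z hz hzl => hlow z hz fun w hw => hzl ?_⟩
      · exact hker (hone hw hul (R.trans (R.symm hz) hu))
      · have h1 := hone hw hul (R.trans (htr hw) (R.trans (R.symm hz) hu))
        exact hcoker (e.toSetoid.trans (e.toSetoid.symm hw) (e.toSetoid.trans h1 hul))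
    · push Not at ht
      exact ⟨x, R.refl x, x, R.refl x, fun z hz _ => hup z hz (ht z hz),
        fun z hz _ => hlow z hz fun w hw => ht w (R.trans hz (R.symm (htr hw))) z hw⟩

/-- If `g` joins `x` to `(σ x)'` and `h` joins `σ x` to `x'` for the points `x` of the support of
`a`, then conjugating `a` by `g` and `h` identifies at least the vertices identified in `a^σ`. -/
theorem permute_le_conj {a g h : PartitionMonoid X} {σ : Equiv.Perm X}
    (hσ : ∀ x ∈ a.support, g.toSetoid (Sum.inl x) (Sum.inr (σ x)) ∧
      h.toSetoid (Sum.inl (σ x)) (Sum.inr x)) :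
    (a.permute σ).toSetoid ≤ (h * a * g).toSetoid := by
  have hsupp : ∀ v, (∀ w, a.toSetoid v w → w = v) ∨ Sum.elim id id v ∈ a.support := by
    rintro (x | x)
    · by_cases hx : x ∈ a.support
      · exact Or.inr hx
      · exact Or.inl (not_not.1 hx).1
    · by_cases hx : x ∈ a.support
      · exact Or.inr hx
      · exact Or.inl (not_not.1 hx).2
  -- First move the upper ends along `h`, then the lower ends along `g`.
  have h1 : ∀ v w, a.toSetoid v w → (h * a).toSetoid (Sum.map σ id v) (Sum.map σ id w) := by
    intro v w hvw
    have aux : ∀ v, Sum.elim id id v ∈ a.support →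
        stack h a (topBot (Sum.map σ id v)) (midBot v) := by
      rintro (x | x) hx
      · exact stack_topMid a (hσ x hx).2
      · exact (stack h a).refl _
    rcases hsupp v with hv | hv
    · rw [hv w hvw]
    · rcases hsupp w with hw | hw
      · rw [hw v (a.toSetoid.symm hvw)]
      · exact (stack h a).trans (aux v hv) ((stack h a).trans (stack_midBot h hvw)
          ((stack h a).symm (aux w hw)))
  have h2 : ∀ v w, a.toSetoid v w → (h * a * g).toSetoid (Sum.map σ σ v) (Sum.map σ σ w) := by
    intro v w hvw
    set S := stack (h * a) g with hS
    have aux : ∀ v, Sum.elim id id v ∈ a.support →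
        S (topBot (Sum.map σ σ v)) (topMid (Sum.map σ id v)) := by
      rintro (x | x) hx
      · exact S.refl _
      · exact S.symm (stack_midBot (h * a) (hσ x hx).1)
    rcases hsupp v with hv | hv
    · rw [hv w hvw]
    · rcases hsupp w with hw | hw
      · rw [hw v (a.toSetoid.symm hvw)]
      · exact S.trans (aux v hv) (S.trans (stack_topMid g (h1 v w hvw)) (S.symm (aux w hw)))
  intro v w hvw
  have := h2 _ _ hvw
  simpa [Sum.map_map] using this

theorem eq_permute_of_conj {a b g h : PartitionMonoid X} {σ : Equiv.Perm X} (hb : h * a * g = b)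
    (ha : g * b * h = a)
    (hσ : ∀ x ∈ a.support, g.toSetoid (Sum.inl x) (Sum.inr (σ x)) ∧
      h.toSetoid (Sum.inl (σ x)) (Sum.inr x))
    (hσ' : ∀ y ∈ b.support, h.toSetoid (Sum.inl y) (Sum.inr (σ.symm y)) ∧
      g.toSetoid (Sum.inl (σ.symm y)) (Sum.inr y)) : b = a.permute σ := by
  refine PartitionMonoid.ext (le_antisymm ?_ (hb ▸ permute_le_conj hσ))
  have h1 : (b.permute σ.symm).toSetoid ≤ a.toSetoid := ha ▸ permute_le_conj hσ'
  intro v w hvw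
  refine h1 ?_
  change b.toSetoid (Sum.map σ σ (Sum.map σ.symm σ.symm v))
    (Sum.map σ σ (Sum.map σ.symm σ.symm w))
  simpa [Sum.map_map] using hvw

/-- The graph of a permutation: its blocks are the sets `{x, (σ x)'}`. -/
def ofPerm (σ : Equiv.Perm X) : PartitionMonoid X := ⟨Setoid.ker (Sum.elim σ id)⟩

theorem ofPerm_mul_ofPerm_symm (σ : Equiv.Perm X) : ofPerm σ * ofPerm σ.symm = 1 := by
  refine PartitionMonoid.ext (le_antisymm ?_ ?_)
  · exact label_eq_of_mul (a := ofPerm σ) (b := ofPerm σ.symm) id σ.symm id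
      (fun v w h => by
        have : Sum.elim σ id v = Sum.elim σ id w := h
        rcases v with v | v <;> rcases w with w | w <;>
          simpa [Equiv.symm_apply_eq, Equiv.eq_symm_apply] using this)
      (fun v w h => h)
  · have aux : ∀ x, (ofPerm σ * ofPerm σ.symm).toSetoid (Sum.inl x) (Sum.inr x) := fun x =>
      mul_inl_inr_iff.2 ⟨σ x, σ x, rfl, Setoid.refl' _ _, σ.symm_apply_apply x⟩
    rintro (v | v) (w | w) h <;> obtain rfl : v = w := h
    · exact Setoid.refl' _ _
    · exact aux _
    · exact Setoid.symm' _ (aux _)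
    · exact Setoid.refl' _ _

theorem naturallyConj_permute (a : PartitionMonoid X) (σ : Equiv.Perm X) :
    NaturallyConj a (a.permute σ) := by
  have h1 := ofPerm_mul_ofPerm_symm σ
  have h := naturallyConj_of_mul_eq (a := a) (g := ofPerm σ) (h := ofPerm σ.symm)
    (by rw [h1, one_mul]) (by rw [h1, mul_one])
  have h2 : ofPerm σ.symm * a * ofPerm σ = a.permute σ := by
    refine eq_permute_of_conj rfl ?_ (fun x _ => ⟨rfl, σ.symm_apply_apply x⟩)
      (fun y _ => ⟨rfl, σ.apply_symm_apply y⟩)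
    rw [← mul_assoc, ← mul_assoc, h1, one_mul, mul_assoc, h1, mul_one]
  rwa [h2] at h

/-- If `a` is in normal form and conjugated by `g` and `h` with idempotent products, then each point
of its support is joined by `g` and `h` to a common point. -/
theorem exists_partner {a b g h : PartitionMonoid X} (ha : a.IsNormalForm) (hb : b.IsNormalForm)
    (hgh : IsIdempotentElem (g * h)) (hhg : IsIdempotentElem (h * g))
    (h1 : g * h * a = a) (h2 : a * (g * h) = a) (h3 : h * g * b = b) (h4 : b * (h * g) = b)
    {x : X} (hx : x ∈ a.support) :
    ∃ y, g.toSetoid (Sum.inl x) (Sum.inr y) ∧ h.toSetoid (Sum.inl y) (Sum.inr x) := by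
  set e := g * h with he
  set R := e.ker ⊔ e.coker with hR
  have hRe : ∀ {x y}, R x y → x = y := fun h => eq_of_ker_sup_coker ha hgh h1 h2 h
  have hk : ∀ {x y}, e.toSetoid (Sum.inl x) (Sum.inl y) → x = y := fun h =>
    hRe ((le_sup_left : e.ker ≤ R) h)
  have hck : ∀ {x y}, e.toSetoid (Sum.inr x) (Sum.inr y) → x = y := fun h =>
    hRe ((le_sup_right : e.coker ≤ R) h)
  have htr : ∀ {z w}, e.toSetoid (Sum.inl z) (Sum.inr w) → z = w := by
    intro z w h
    have h' := h
    rw [← hgh.eq] at h'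
    obtain ⟨z', w', h1, h2, h3⟩ := mul_inl_inr_iff.1 h'
    rw [sup_comm] at h2
    rw [hck (e.toSetoid.trans (e.toSetoid.symm h) h1), hRe h2,
      hk (e.toSetoid.trans h3 (e.toSetoid.symm h))]
  have hxx : e.toSetoid (Sum.inl x) (Sum.inr x) := by
    by_contra hn
    refine hx ⟨fun v hv => ?_, fun v hv => ?_⟩
    · rw [← h1] at hv
      have := mul_rel_of_forall_not (fun z hz => hn (by rwa [← htr hz] at hz)) hv
      rcases v with v | v
      · rw [hk this]
      · exact (hn (by rwa [← htr this] at this)).elim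
    · have hv' : (e.flip * a.flip).toSetoid (Sum.inl x) v.swap := by
        rw [flip_mul_flip_eq h2]
        simpa [flip_rel] using hv
      have := mul_rel_of_forall_not (fun z hz => hn ?_) hv'
      · rcases v with v | v
        · have h' := e.toSetoid.symm this
          exact (hn (by rwa [Sum.swap_inl, Sum.swap_inr, Sum.swap_inl, htr h'] at h')).elim
        · rw [hck this]
      · have h' := e.toSetoid.symm hz
        rwa [Sum.swap_inl, Sum.swap_inr, htr h'] at h'
  obtain ⟨z, w, hz, hzw, hw⟩ := mul_inl_inr_iff.1 hxx
  have : g.coker ⊔ h.ker ≤ (h * g).ker ⊔ (h * g).coker :=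
    sup_le ((coker_le_coker_mul h g).trans le_sup_right) ((ker_le_ker_mul h g).trans le_sup_left)
  obtain rfl := eq_of_ker_sup_coker hb hhg h3 h4 (this hzw)
  exact ⟨z, hz, hw⟩

instance [Finite X] : Finite (PartitionMonoid X) :=
  Finite.of_injective (fun a => (a.toSetoid : X ⊕ X → X ⊕ X → Prop)) fun _ _ h =>
    PartitionMonoid.ext (Setoid.ext fun u v => iff_of_eq (congrFun (congrFun h u) v))

theorem exists_eq_permute [Finite X] {a b : PartitionMonoid X} (ha : a.IsNormalForm)
    (hb : b.IsNormalForm) (hab : NaturallyConj a b) : ∃ σ : Equiv.Perm X, b = a.permute σ := by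
  obtain ⟨g, h, i1, i2, h1, h2, h3, h4, h5, h6⟩ := exists_idempotent_conjugators hab
  set D : Set X := {x | ∃ y, g.toSetoid (Sum.inl x) (Sum.inr y) ∧
    h.toSetoid (Sum.inl y) (Sum.inr x)} with hD
  have hD' : ∀ x : D, ∃ y, g.toSetoid (Sum.inl x.1) (Sum.inr y) ∧
    h.toSetoid (Sum.inl y) (Sum.inr x.1) := fun x => x.2
  choose f hfg hfh using hD'
  have hinj : Function.Injective f := by
    intro x y hxy
    have hx := hfh x
    rw [hxy] at hx
    exact Subtype.ext (eq_of_ker_sup_coker ha i1 h1 h2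
      ((coker_le_coker_mul g h).trans le_sup_right (h.toSetoid.trans (h.toSetoid.symm hx) (hfh y))))
  obtain ⟨σ, hσ⟩ := Equiv.Perm.exists_extending_pair (Subtype.val : D → X) f
    Subtype.val_injective hinj
  refine ⟨σ, eq_permute_of_conj h5 h6 (fun x hx => ?_) (fun y hy => ?_)⟩
  · have hxD : x ∈ D := exists_partner ha hb i1 i2 h1 h2 h3 h4 hx
    rw [show σ x = f ⟨x, hxD⟩ from hσ ⟨x, hxD⟩]
    exact ⟨hfg ⟨x, hxD⟩, hfh ⟨x, hxD⟩⟩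
  · obtain ⟨x, hx1, hx2⟩ := exists_partner hb ha i2 i1 h3 h4 h1 h2 hy
    have hxD : x ∈ D := ⟨y, hx2, hx1⟩
    have hy' : f ⟨x, hxD⟩ = y := eq_of_ker_sup_coker hb i2 h3 h4
      ((coker_le_coker_mul h g).trans le_sup_right
        (g.toSetoid.trans (g.toSetoid.symm (hfg ⟨x, hxD⟩)) hx2))
    have : σ.symm y = x := by
      rw [Equiv.symm_apply_eq, ← hy']
      exact (hσ ⟨x, hxD⟩).symm
    rw [this]
    exact ⟨hx1, hx2⟩

end PartitionMonoid

theorem mainTheorem3 (n : ℕ) :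
    (∀ a : PartitionMonoid (Fin n), ∃ b ∈ natConjClass a, b.IsNormalForm) ∧
    (∀ a b : PartitionMonoid (Fin n), a.IsNormalForm → b.IsNormalForm →
      (NaturallyConj a b ↔ ∃ σ : Equiv.Perm (Fin n), b = a.permute σ)) := by
  refine ⟨fun a => PartitionMonoid.exists_naturallyConj_isNormalForm a, fun a b ha hb =>
    ⟨PartitionMonoid.exists_eq_permute ha hb, ?_⟩⟩
  rintro ⟨σ, rfl⟩
  exact PartitionMonoid.naturallyConj_permute a σ
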